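/- Let $(V,\omega)$ be a finite-dimensional complex symplectic vector space, $\dim_{\mathbb C}V=2n$, with a compatible real structure $\tau$, i.e. a $\mathbb C$-antilinear involution $\tau:V\to V$ such that $\omega$ restricts to a real symplectic form on the fixed point set $V^\tau$, and let $\gamma(u,v)=\sqrt{-1}\,\omega(u,\tau v)$. Let $V^\tau=L_0\oplus L_0'$ be a decomposition into Lagrangian subspaces, and let $V=L\oplus L'$ be its complexification. Let $M\subset V$ be a Lagrangian pseudo-Kähler submanifold, i.e. a complex submanifold such that every $T_mM$ is a Lagrangian subspace of $(V,\omega)$ and $\gamma|_{T_mM}$ is nondegenerate, and assume that $M$ is in general position, i.e. the projection $p:V\to L$ along $L'$ induces an isomorphism of $M$ onto its image. Let $N=T^*M$ be the holomorphic cotangent bundle of $M$ (the manifold that carries the pseudo hyper-Kähler structure associated with these data). Let $\mathrm{Aut}_{sd}(M)$ be the group of all $\varphi\in GL_{\mathbb C}(V)$ that preserve $\omega$, commute with $\tau$ and satisfy $\varphi M=M$, $\varphi L=L$, $\varphi L'=L'$. The affine group $V^\tau\rtimes \mathrm{Aut}_{sd}(M)$ acts on $N$ as follows: $\varphi\in \mathrm{Aut}_{sd}(M)$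 acts by the point transformation $T^*_mM\ni\sigma\mapsto\sigma\circ(d\varphi_m)^{-1}\in T^*_{\varphi m}M$, and $v\in V^\tau$ acts by $T^*_mM\ni\sigma\mapsto\sigma+\sqrt{-1}\,\psi_m(v)\in T^*_mM$, where $\psi_m(v)=\omega(v,\cdot)|_{T_mM}$. If a subgroup $A\subset \mathrm{Aut}_{sd}(M)$ has an orbit of (real) codimension $r$ on $M$, then the subgroup $V^\tau\rtimes A\subset V^\tau\rtimes \mathrm{Aut}_{sd}(M)$ has an orbit of (real) codimension $r$ on $N$. Here an orbit is said to have codimension $r$ if it is an immersed submanifold of codimension $r$, i.e. the image of an injective smooth immersion of a second countable Hausdorff smooth manifold of dimension $r$ less than that of the ambient real manifold. -/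

import Mathlib

open scoped Manifold ContDiff
open Bundle

set_option linter.unusedSectionVars false

noncomputable section

/-- Fundamental algebraic data `(V, ω, τ)`: a complex symplectic vector space `(V, form)` and a
compatible real structure `τ = conj`, i.e. a `ℂ`-antilinear involution such that `form` restricts
to a real symplectic form on the fixed point set of `conj`. -/
structure FundamentalData (V : Type*) [AddCommGroup V] [Module ℂ V] where
  /-- the complex symplectic form `ω` -/
  form : V →ₗ[ℂ] V →ₗ[ℂ] ℂ
  form_self : ∀ u, form u u = 0
  form_nondegenerate : ∀ u, (∀ v, form u v = 0) → u = 0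
  /-- the real structure `τ` -/
  conj : V →ₛₗ[starRingEnd ℂ] V
  conj_conj : ∀ u, conj (conj u) = u
  form_real : ∀ u v, conj u = u → conj v = v → (form u v).im = 0
  form_real_nondegenerate :
    ∀ u, conj u = u → (∀ v, conj v = v → form u v = 0) → u = 0

/-- A submodule `W` of `T` is a Lagrangean subspace of `(T, B)` if it is maximal among the
isotropic subspaces of `T`. The ambient `T` is a subspace of `V`. -/
def IsLagrangean {R V : Type*} [Semiring R] [AddCommGroup V] [Module R V]
    (B : V → V → ℂ) (T W : Submodule R V) : Prop :=
  Maximal (fun U : Submodule R V => U ≤ T ∧ ∀ u ∈ U, ∀ v ∈ U, B u v = 0) W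

namespace FundamentalData

variable {V : Type*} [AddCommGroup V] [Module ℂ V] (D : FundamentalData V)

/-- The real symplectic vector space `V^τ` of fixed points of the real structure. -/
def realPart : Submodule ℝ V where
  carrier := {v | D.conj v = v}
  add_mem' := by
    intro a b ha hb
    simp only [Set.mem_ofPred_eq] at *
    rw [map_add, ha, hb]
  zero_mem' := map_zero _
  smul_mem' := by
    intro c x hx
    simp only [Set.mem_ofPred_eq] at *
    rw [← Complex.coe_smul, LinearMap.map_smulₛₗ, hx, Complex.conj_ofReal]

theorem mem_realPart {v : V} : v ∈ D.realPart ↔ D.conj v = v := Iff.rfl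

/-- The Hermitian form `γ(u, v) = √-1 ω(u, τ v)`. -/
def hermForm (u v : V) : ℂ := Complex.I * D.form u (D.conj v)

/-- The group `Aut(V, ω, τ)` of linear automorphisms of the fundamental algebraic data. -/
def aut : Subgroup (V ≃ₗ[ℂ] V) where
  carrier := {φ | (∀ u v, D.form (φ u) (φ v) = D.form u v) ∧ ∀ u, φ (D.conj u) = D.conj (φ u)}
  mul_mem' := by
    rintro a b ⟨ha, ha'⟩ ⟨hb, hb'⟩
    refine ⟨fun u v => ?_, fun u => ?_⟩
    · simp only [LinearEquiv.mul_apply, ha, hb]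
    · simp only [LinearEquiv.mul_apply, ha', hb']
  one_mem' := ⟨fun _ _ => rfl, fun _ => rfl⟩
  inv_mem' := by
    rintro a ⟨ha, ha'⟩
    refine ⟨fun u v => ?_, fun u => ?_⟩
    · rw [← ha]; simp
    · apply a.injective
      rw [ha']; simp

/-- The duality group `Aut_d(M) = {φ ∈ Aut(V, ω, τ) | φ M = M}`. -/
def autD (M : Set V) : Subgroup (V ≃ₗ[ℂ] V) where
  carrier := {φ | φ ∈ D.aut ∧ φ '' M = M}
  mul_mem' := by
    rintro a b ⟨ha, ha'⟩ ⟨hb, hb'⟩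
    refine ⟨mul_mem ha hb, ?_⟩
    have : (⇑(a * b) : V → V) = a ∘ b := rfl
    rw [this, Set.image_comp, hb', ha']
  one_mem' := ⟨one_mem _, by
    have : (⇑(1 : V ≃ₗ[ℂ] V) : V → V) = id := rfl
    rw [this, Set.image_id]⟩
  inv_mem' := by
    rintro a ⟨ha, ha'⟩
    refine ⟨inv_mem ha, ?_⟩
    conv_lhs => rw [← ha']
    rw [← Set.image_comp]
    have : (⇑(a⁻¹) ∘ ⇑a : V → V) = id := by
      funext x
      exact a.symm_apply_apply x
    rw [this, Set.image_id]

end FundamentalData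

/-- A Lagrangean splitting `V^τ = L₀ ⊕ L₀'` of the real symplectic vector space `V^τ`. -/
structure LagrangeanSplitting {V : Type*} [AddCommGroup V] [Module ℂ V]
    (D : FundamentalData V) where
  L₀ : Submodule ℝ V
  L₀' : Submodule ℝ V
  lagrangean : IsLagrangean (fun u v => D.form u v) D.realPart L₀
  lagrangean' : IsLagrangean (fun u v => D.form u v) D.realPart L₀'
  disjoint : L₀ ⊓ L₀' = ⊥
  sup_eq : L₀ ⊔ L₀' = D.realPart

namespace LagrangeanSplitting

variable {V : Type*} [AddCommGroup V] [Module ℂ V] {D : FundamentalData V}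
  (S : LagrangeanSplitting D)

/-- The complexification `L` of `L₀`: the subspace of `V` with `τ L = L` and `L^τ = L₀`. -/
def L : Submodule ℂ V := Submodule.span ℂ (S.L₀ : Set V)

/-- The complexification `L'` of `L₀'`: the subspace of `V` with `τ L' = L'` and
`(L')^τ = L₀'`. -/
def L' : Submodule ℂ V := Submodule.span ℂ (S.L₀' : Set V)

theorem exists_of_mem_span {W : Submodule ℝ V} {x : V}
    (hx : x ∈ Submodule.span ℂ (W : Set V)) :
    ∃ a ∈ W, ∃ b ∈ W, x = a + Complex.I • b := by
  induction hx using Submodule.span_induction with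
  | mem x h => exact ⟨x, h, 0, W.zero_mem, by simp⟩
  | zero => exact ⟨0, W.zero_mem, 0, W.zero_mem, by simp⟩
  | add x y _ _ hx hy =>
    obtain ⟨a, ha, b, hb, rfl⟩ := hx
    obtain ⟨c, hc, d, hd, rfl⟩ := hy
    exact ⟨a + c, W.add_mem ha hc, b + d, W.add_mem hb hd, by module⟩
  | smul z x _ hx =>
    obtain ⟨a, ha, b, hb, rfl⟩ := hx
    refine ⟨z.re • a - z.im • b, W.sub_mem (W.smul_mem _ ha) (W.smul_mem _ hb),
      z.im • a + z.re • b, W.add_mem (W.smul_mem _ ha) (W.smul_mem _ hb), ?_⟩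
    conv_lhs => rw [← Complex.re_add_im z]
    have h : (z.im * Complex.I) • Complex.I • b = -((z.im : ℂ) • b) := by
      rw [smul_smul, mul_assoc, Complex.I_mul_I, mul_neg_one, neg_smul]
    simp only [← Complex.coe_smul, smul_add, add_smul, h]
    module

theorem eq_zero_of_add_I_smul {a b : V} (ha : D.conj a = a) (hb : D.conj b = b)
    (h : a + Complex.I • b = 0) : a = 0 ∧ b = 0 := by
  have h1 : a - Complex.I • b = 0 := by
    have := congrArg D.conj h
    rw [map_add, LinearMap.map_smulₛₗ, ha, hb, map_zero, Complex.conj_I, neg_smul] at this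
    rw [sub_eq_add_neg, this]
  have h2 : (2 : ℂ) • a = 0 := by
    have := congrArg₂ (· + ·) h h1
    simp only [add_zero] at this
    rw [← this]; module
  have ha0 : a = 0 := (smul_eq_zero.1 h2).resolve_left two_ne_zero
  refine ⟨ha0, ?_⟩
  rw [ha0, zero_add] at h
  exact (smul_eq_zero.1 h).resolve_left Complex.I_ne_zero

/-- `V = L ⊕ L'`. -/
theorem isCompl : IsCompl S.L S.L' := by
  have hL : S.L₀ ≤ D.realPart := S.lagrangean.prop.1
  have hL' : S.L₀' ≤ D.realPart := S.lagrangean'.prop.1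
  refine ⟨?_, ?_⟩
  · rw [Submodule.disjoint_def]
    intro x hx hx'
    obtain ⟨a, ha, b, hb, rfl⟩ := exists_of_mem_span hx
    obtain ⟨c, hc, d, hd, h⟩ := exists_of_mem_span hx'
    have h0 : (a - c) + Complex.I • (b - d) = 0 := by
      rw [← sub_eq_zero] at h
      rw [← h]; module
    have h1 := eq_zero_of_add_I_smul (D.realPart.sub_mem (hL ha) (hL' hc))
      (D.realPart.sub_mem (hL hb) (hL' hd)) h0
    have ha0 : a = 0 := by
      have : a ∈ S.L₀ ⊓ S.L₀' := ⟨ha, by rw [sub_eq_zero.1 h1.1]; exact hc⟩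
      rwa [S.disjoint, Submodule.mem_bot] at this
    have hb0 : b = 0 := by
      have : b ∈ S.L₀ ⊓ S.L₀' := ⟨hb, by rw [sub_eq_zero.1 h1.2]; exact hd⟩
      rwa [S.disjoint, Submodule.mem_bot] at this
    rw [ha0, hb0]; simp
  · rw [codisjoint_iff_le_sup]
    intro x _
    have key : ∀ y ∈ D.realPart, y ∈ S.L ⊔ S.L' := by
      intro y hy
      rw [← S.sup_eq] at hy
      obtain ⟨u, hu, v, hv, rfl⟩ := Submodule.mem_sup.1 hy
      exact Submodule.add_mem_sup (Submodule.subset_span hu) (Submodule.subset_span hv)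
    have h1 : x + D.conj x ∈ D.realPart := by
      rw [D.mem_realPart, map_add, D.conj_conj, add_comm]
    have h2 : Complex.I • (x - D.conj x) ∈ D.realPart := by
      rw [D.mem_realPart, LinearMap.map_smulₛₗ, map_sub, D.conj_conj, Complex.conj_I]
      module
    have h3 : x = (1 / 2 : ℂ) • (x + D.conj x)
        + (-(1 / 2 : ℂ) * Complex.I) • (Complex.I • (x - D.conj x)) := by
      rw [smul_smul, mul_assoc, Complex.I_mul_I]
      module
    rw [h3]
    exact Submodule.add_mem _ (Submodule.smul_mem _ _ (key _ h1))
      (Submodule.smul_mem _ _ (key _ h2))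

/-- The projection `p : V → L` along `L'`. -/
def proj : V →ₗ[ℂ] S.L := S.L.projectionOnto S.L' S.isCompl

/-- The group `Aut_sd(M) = {φ ∈ Aut_d(M) | φ L = L, φ L' = L'}`. -/
def autSD (M : Set V) : Subgroup (V ≃ₗ[ℂ] V) where
  carrier := {φ | φ ∈ D.autD M ∧ φ '' (S.L : Set V) = S.L ∧ φ '' (S.L' : Set V) = S.L'}
  mul_mem' := by
    rintro a b ⟨ha, ha', ha''⟩ ⟨hb, hb', hb''⟩
    have : (⇑(a * b) : V → V) = a ∘ b := rfl
    refine ⟨mul_mem ha hb, ?_, ?_⟩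
    · rw [this, Set.image_comp, hb', ha']
    · rw [this, Set.image_comp, hb'', ha'']
  one_mem' := by
    have : (⇑(1 : V ≃ₗ[ℂ] V) : V → V) = id := rfl
    exact ⟨one_mem _, by rw [this, Set.image_id], by rw [this, Set.image_id]⟩
  inv_mem' := by
    rintro a ⟨ha, ha', ha''⟩
    have : (⇑(a⁻¹) ∘ ⇑a : V → V) = id := by
      funext x
      exact a.symm_apply_apply x
    refine ⟨inv_mem ha, ?_, ?_⟩
    · conv_lhs => rw [← ha']
      rw [← Set.image_comp, this, Set.image_id]
    · conv_lhs => rw [← ha'']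
      rw [← Set.image_comp, this, Set.image_id]

variable {S} {M : Set V}

theorem conj_comm (φ : S.autSD M) (v : V) :
    (φ : V ≃ₗ[ℂ] V) (D.conj v) = D.conj ((φ : V ≃ₗ[ℂ] V) v) := φ.2.1.1.2 v

theorem form_comm (φ : S.autSD M) (u v : V) :
    D.form ((φ : V ≃ₗ[ℂ] V) u) ((φ : V ≃ₗ[ℂ] V) v) = D.form u v := φ.2.1.1.1 u v

variable (S M)

/-- The linear action of `Aut_sd(M)` on the vector group `V^τ` (written multiplicatively). -/
def realAction : S.autSD M →* MulAut (Multiplicative D.realPart) where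
  toFun φ := AddEquiv.toMultiplicative
    { toFun := fun v => ⟨(φ : V ≃ₗ[ℂ] V) v, by
        rw [D.mem_realPart, ← conj_comm, D.mem_realPart.1 v.2]⟩
      invFun := fun v => ⟨((φ⁻¹ : S.autSD M) : V ≃ₗ[ℂ] V) v, by
        rw [D.mem_realPart, ← conj_comm, D.mem_realPart.1 v.2]⟩
      left_inv := fun v => Subtype.ext ((φ : V ≃ₗ[ℂ] V).symm_apply_apply v)
      right_inv := fun v => Subtype.ext ((φ : V ≃ₗ[ℂ] V).apply_symm_apply v)
      map_add' := fun u v => Subtype.ext (map_add (φ : V ≃ₗ[ℂ] V) (u : V) v) }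
  map_one' := rfl
  map_mul' _ _ := rfl

/-- The affine group `V^τ ⋊ Aut_sd(M)`. -/
abbrev affineGroup : Type _ := Multiplicative D.realPart ⋊[S.realAction M] S.autSD M

variable {S M}

/-- The subgroup `V^τ ⋊ A` of `V^τ ⋊ Aut_sd(M)` for a subgroup `A` of `Aut_sd(M)`. -/
def affineSubgroup (A : Subgroup (S.autSD M)) : Subgroup (S.affineGroup M) :=
  A.comap SemidirectProduct.rightHom

/-- `Aut_sd(M)` acts on `M` by restriction. -/
instance baseAction : MulAction (S.autSD M) M where
  smul φ m := ⟨(φ : V ≃ₗ[ℂ] V) m, by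
    have h : (φ : V ≃ₗ[ℂ] V) '' M = M := φ.2.1.2
    exact h.le (Set.mem_image_of_mem _ m.2)⟩
  one_smul _ := rfl
  mul_smul _ _ _ := rfl

theorem coe_smul (φ : S.autSD M) (m : M) : ((φ • m : M) : V) = (φ : V ≃ₗ[ℂ] V) m := rfl

end LagrangeanSplitting

section Submanifold

variable {V : Type*} [NormedAddCommGroup V] [NormedSpace ℂ V]
  (E : Type*) [NormedAddCommGroup E] [NormedSpace ℂ E]
  (M : Set V) [ChartedSpace E M]

/-- The derivative `T_m M → V` of the inclusion `M ⊂ V`. -/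
def inclDeriv (m : M) : TangentSpace 𝓘(ℂ, E) m →L[ℂ] V :=
  mfderiv 𝓘(ℂ, E) 𝓘(ℂ, V) (Subtype.val : M → V) m

/-- The tangent space `T_m M`, considered as a subspace of `V`. -/
def tangentSubspace (m : M) : Submodule ℂ V := LinearMap.range (inclDeriv E M m).toLinearMap

/-- `M ⊂ V`, a complex manifold modelled on `E` whose topology is the subspace topology, is a
Lagrangean pseudo Kähler submanifold of `(V, ω, γ)`: the inclusion is a holomorphic immersion, each
tangent space is a Lagrangean subspace of `(V, ω)`, and `γ` is nondegenerate on it. -/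
structure IsLagrangeanPseudoKahler (D : FundamentalData V) : Prop where
  contMDiff_val : ContMDiff 𝓘(ℂ, E) 𝓘(ℂ, V) ω (Subtype.val : M → V)
  immersion : ∀ m : M, Function.Injective (inclDeriv E M m)
  lagrangean : ∀ m : M, IsLagrangean (fun u v => D.form u v) ⊤ (tangentSubspace E M m)
  nondegenerate : ∀ m : M, ∀ u ∈ tangentSubspace E M m,
    (∀ v ∈ tangentSubspace E M m, D.hermForm u v = 0) → u = 0

/-- `M` is in general position with respect to the splitting `V = L ⊕ L'`: the projection
`p : V → L` along `L'` induces an isomorphism of complex manifolds from `M` onto its image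
(an open subset of `L`, as `L` and a Lagrangean submanifold `M` have the same dimension). -/
structure InGeneralPosition {D : FundamentalData V} (S : LagrangeanSplitting D) : Prop where
  injective : Function.Injective (fun m : M => S.proj m)
  isLocalDiffeomorph :
    IsLocalDiffeomorph 𝓘(ℂ, E) 𝓘(ℂ, S.L) ω (fun m : M => S.proj m)

/-- The fibre `T*_m M` of the holomorphic cotangent bundle. -/
abbrev Covector (m : M) : Type _ := TangentSpace 𝓘(ℂ, E) m →L[ℂ] Trivial M ℂ m

/-- The total space `N = T*M` of the holomorphic cotangent bundle of `M`. -/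
abbrev Cotangent : Type _ := TotalSpace (E →L[ℂ] ℂ) (Covector E M)

end Submanifold

namespace LagrangeanSplitting

variable {V : Type*} [NormedAddCommGroup V] [NormedSpace ℂ V] [FiniteDimensional ℂ V]
  {E : Type*} [NormedAddCommGroup E] [NormedSpace ℂ E]
  {M : Set V} [ChartedSpace E M] {D : FundamentalData V} {S : LagrangeanSplitting D}

variable (E) in
/-- The differential `dφ_m : T_m M → T_{φ m} M` of the action of `φ` on `M`. -/
def smulDeriv (φ : S.autSD M) (m : M) :
    TangentSpace 𝓘(ℂ, E) m →L[ℂ] TangentSpace 𝓘(ℂ, E) (φ • m) :=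
  mfderiv 𝓘(ℂ, E) 𝓘(ℂ, E) (fun x : M => φ • x) m

theorem mdifferentiable_smul (hM : IsLagrangeanPseudoKahler E M D) (hp : InGeneralPosition E M S)
    (φ : S.autSD M) : MDifferentiable 𝓘(ℂ, E) 𝓘(ℂ, E) (fun x : M => φ • x) := by
  intro m
  have hcont : Continuous (fun x : M => φ • x) := by
    refine Continuous.subtype_mk ?_ _
    exact ((φ : V ≃ₗ[ℂ] V).toLinearMap.toContinuousLinearMap.continuous).comp
      continuous_subtype_val
  have hq := hp.isLocalDiffeomorph (φ • m)
  have hval : MDifferentiable 𝓘(ℂ, E) 𝓘(ℂ, V) (Subtype.val : M → V) :=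
    hM.contMDiff_val.mdifferentiable (by simp)
  let T : V →L[ℂ] S.L :=
    (S.proj ∘ₗ (φ : V ≃ₗ[ℂ] V).toLinearMap).toContinuousLinearMap
  have hT : MDifferentiable 𝓘(ℂ, E) 𝓘(ℂ, S.L) (fun x : M => S.proj ((φ • x : M) : V)) :=
    T.differentiable.mdifferentiable.comp hval
  have h1 : MDifferentiableAt 𝓘(ℂ, E) 𝓘(ℂ, E)
      (hq.localInverse ∘ (fun x : M => S.proj ((φ • x : M) : V))) m :=
    MDifferentiableAt.comp m (hq.localInverse_mdifferentiableAt (by simp)) (hT m)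
  refine h1.congr_of_eventuallyEq ?_
  have h2 := (hcont.tendsto m).eventually hq.localInverse_eventuallyEq_left
  filter_upwards [h2] with x hx
  exact hx.symm

theorem inclDeriv_smulDeriv (hM : IsLagrangeanPseudoKahler E M D) (hp : InGeneralPosition E M S)
    (φ : S.autSD M) (m : M) (X : TangentSpace 𝓘(ℂ, E) m) :
    inclDeriv E M (φ • m) (smulDeriv E φ m X) = (φ : V ≃ₗ[ℂ] V) (inclDeriv E M m X) := by
  have hval : MDifferentiable 𝓘(ℂ, E) 𝓘(ℂ, V) (Subtype.val : M → V) :=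
    hM.contMDiff_val.mdifferentiable (by simp)
  let T : V →L[ℂ] V := (φ : V ≃ₗ[ℂ] V).toLinearMap.toContinuousLinearMap
  have h1 := mfderiv_comp m (hval (φ • m)) (mdifferentiable_smul hM hp φ m)
  have h2 := mfderiv_comp m (T.differentiable.mdifferentiable (m : V)) (hval m)
  have h3 : (Subtype.val ∘ (fun x : M => φ • x) : M → V) = T ∘ Subtype.val := rfl
  rw [h3, h2, T.mfderiv_eq] at h1
  exact (DFunLike.congr_fun h1 X).symm

theorem smulDeriv_one (m : M) : smulDeriv E (1 : S.autSD M) m = ContinuousLinearMap.id ℂ _ :=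
  mfderiv_id

theorem smulDeriv_mul (hM : IsLagrangeanPseudoKahler E M D) (hp : InGeneralPosition E M S)
    (φ χ : S.autSD M) (m : M) :
    smulDeriv E (φ * χ) m = (smulDeriv E φ (χ • m)).comp (smulDeriv E χ m) :=
  mfderiv_comp m (mdifferentiable_smul hM hp φ (χ • m)) (mdifferentiable_smul hM hp χ m)

theorem isInvertible_smulDeriv (hM : IsLagrangeanPseudoKahler E M D)
    (hp : InGeneralPosition E M S) (φ : S.autSD M) (m : M) :
    (smulDeriv E φ m).IsInvertible := by
  have hinj : Function.Injective (smulDeriv E φ m) := by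
    intro X Y h
    apply hM.immersion m
    apply (φ : V ≃ₗ[ℂ] V).injective
    rw [← inclDeriv_smulDeriv hM hp, ← inclDeriv_smulDeriv hM hp, h]
  have hfin : FiniteDimensional ℂ E :=
    FiniteDimensional.of_injective (V := E) (inclDeriv E M m).toLinearMap (hM.immersion m)
  have key : ∀ f : E →L[ℂ] E, Function.Injective f → f.IsInvertible := fun f hf =>
    ⟨(LinearEquiv.ofInjectiveEndo f.toLinearMap hf).toContinuousLinearEquiv, by ext; rfl⟩
  exact key _ hinj

/-- The map `(dφ_m⁻¹)* : T*_m M → T*_{φ m} M`, `σ ↦ σ ∘ (dφ_m)⁻¹`. -/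
def pushCovector (φ : S.autSD M) (m : M) (σ : Covector E M m) : Covector E M (φ • m) :=
  σ ∘L (smulDeriv E φ m).inverse

/-- The action of `φ ∈ Aut_sd(M)` on `T*M` by point transformations. -/
def pointTransformation (φ : S.autSD M) (σ : Cotangent E M) : Cotangent E M :=
  ⟨φ • σ.proj, pushCovector φ σ.proj σ.snd⟩

theorem pushCovector_one (m : M) (σ : Covector E M m) :
    pushCovector (1 : S.autSD M) m σ = σ := by
  unfold pushCovector
  rw [smulDeriv_one]
  erw [ContinuousLinearMap.inverse_id]
  rfl

theorem pushCovector_mul (hM : IsLagrangeanPseudoKahler E M D) (hp : InGeneralPosition E M S)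
    (φ χ : S.autSD M) (m : M) (σ : Covector E M m) :
    pushCovector (φ * χ) m σ = pushCovector φ (χ • m) (pushCovector χ m σ) := by
  unfold pushCovector
  rw [smulDeriv_mul hM hp]
  erw [(isInvertible_smulDeriv hM hp φ (χ • m)).inverse_comp_of_left]
  rfl

variable (E) in
/-- The map `ψ_m : V^τ → T*_m M` induced by `V → V / T_m M ≅ T*_m M`, i.e.
`ψ_m(v) = ω(v, ·)|_{T_m M}`. -/
def psi (D : FundamentalData V) (m : M) (v : D.realPart) : Covector E M m :=
  (D.form (v : V)).toContinuousLinearMap ∘L inclDeriv E M m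

theorem psi_zero (m : M) : psi E D m 0 = 0 := by
  ext X
  exact LinearMap.congr_fun (map_zero D.form) _

theorem psi_add (m : M) (v w : D.realPart) : psi E D m (v + w) = psi E D m v + psi E D m w := by
  ext X
  exact LinearMap.congr_fun (map_add D.form (v : V) w) _

theorem pushCovector_psi (hM : IsLagrangeanPseudoKahler E M D) (hp : InGeneralPosition E M S)
    (φ : S.autSD M) (m : M) (w : Multiplicative D.realPart) :
    pushCovector φ m (psi E D m w.toAdd)
      = psi E D (φ • m) (S.realAction M φ w).toAdd := by
  ext Y
  obtain ⟨X, rfl⟩ := (isInvertible_smulDeriv hM hp φ m).surjective Y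
  change D.form _ (inclDeriv E M m ((smulDeriv E φ m).inverse (smulDeriv E φ m X)))
    = D.form ((φ : V ≃ₗ[ℂ] V) _) (inclDeriv E M (φ • m) (smulDeriv E φ m X))
  rw [(isInvertible_smulDeriv hM hp φ m).inverse_apply_self, inclDeriv_smulDeriv hM hp,
    form_comm]

/-- The fibre preserving action of `v ∈ V^τ` on `T*M`:
`T*_m M ∋ σ ↦ σ + √-1 ψ_m(v) ∈ T*_m M`. -/
def translation (v : D.realPart) (σ : Cotangent E M) : Cotangent E M :=
  ⟨σ.proj, σ.snd + Complex.I • psi E D σ.proj v⟩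

/-- The action of the affine group `V^τ ⋊ Aut_sd(M)` on `N = T*M`. -/
@[reducible]
def affineAction (hM : IsLagrangeanPseudoKahler E M D) (hp : InGeneralPosition E M S) :
    MulAction (S.affineGroup M) (Cotangent E M) where
  smul g σ := translation (Multiplicative.toAdd g.left) (pointTransformation g.right σ)
  one_smul σ := by
    obtain ⟨m, σ⟩ := σ
    refine congrArg (TotalSpace.mk (F := E →L[ℂ] ℂ) m) ?_
    have h0 : ∀ a b : Covector E M m, a = σ → b = 0 → a + Complex.I • b = σ := by
      rintro a b rfl rfl
      ext X
      simp
    exact h0 _ _ (pushCovector_one m σ) (psi_zero m)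
  mul_smul g h σ := by
    obtain ⟨v, φ⟩ := g
    obtain ⟨w, χ⟩ := h
    obtain ⟨m, σ⟩ := σ
    refine congrArg (TotalSpace.mk (F := E →L[ℂ] ℂ) (φ • χ • m)) ?_
    change @id (Covector E M (φ • χ • m)) (pushCovector (φ * χ) m σ)
        + Complex.I • psi E D (φ • χ • m) (v.toAdd + (S.realAction M φ w).toAdd)
      = pushCovector φ (χ • m) (pushCovector χ m σ + Complex.I • psi E D (χ • m) w.toAdd)
          + Complex.I • psi E D (φ • χ • m) v.toAdd
    have h1 : pushCovector φ (χ • m)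
          (pushCovector χ m σ + Complex.I • psi E D (χ • m) w.toAdd)
        = pushCovector φ (χ • m) (pushCovector χ m σ)
          + Complex.I • psi E D (φ • χ • m) (S.realAction M φ w).toAdd := by
      rw [← pushCovector_psi hM hp]
      rfl
    have h2 : ∀ a b c d : Covector E M (φ • χ • m), a = b →
        a + Complex.I • (c + d) = b + Complex.I • d + Complex.I • c := by
      rintro a b c d rfl
      ext X
      simp only [add_apply, smul_apply, smul_add]
      abel
    rw [h1, psi_add]
    exact h2 _ _ _ _ (pushCovector_mul hM hp φ χ m σ)

/-- The orbit of `σ ∈ N = T*M` under the subgroup `V^τ ⋊ A ⊂ V^τ ⋊ Aut_sd(M)`. -/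
def affineOrbit (hM : IsLagrangeanPseudoKahler E M D) (hp : InGeneralPosition E M S)
    (A : Subgroup (S.autSD M)) (σ : Cotangent E M) : Set (Cotangent E M) :=
  letI := affineAction hM hp
  MulAction.orbit (affineSubgroup A) σ

end LagrangeanSplitting

/-- A subset `S` of a real manifold `X` (modelled on `I`) has codimension `r`: it is an immersed
submanifold of codimension `r`, i.e. the image of an injective smooth immersion `f : P → X` of
a Hausdorff, second countable smooth manifold `P` of dimension `dim X - r`. The orbits of a
(second countable) Lie group acting smoothly are of this kind, with `P = G / G_x`.
It is no restriction to take `P` and its model space `F` in the lowest universe. -/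
def HasCodimension {B H X : Type*} [NormedAddCommGroup B] [NormedSpace ℝ B] [TopologicalSpace H]
    (I : ModelWithCorners ℝ B H) [TopologicalSpace X] [ChartedSpace H X]
    (S : Set X) (r : ℕ) : Prop :=
  ∃ (F : Type) (_ : NormedAddCommGroup F) (_ : NormedSpace ℝ F) (_ : FiniteDimensional ℝ F)
    (P : Type) (_ : TopologicalSpace P) (_ : T2Space P) (_ : SecondCountableTopology P)
    (_ : ChartedSpace F P) (_ : IsManifold 𝓘(ℝ, F) ∞ P) (f : P → X),
    ContMDiff 𝓘(ℝ, F) I ∞ f ∧ Function.Injective f ∧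
      (∀ x, Function.Injective (mfderiv 𝓘(ℝ, F) I f x)) ∧
      Set.range f = S ∧ Module.finrank ℝ F + r = Module.finrank ℝ B

end

/-! The real linear map `√-1 ψ_m : V^τ → T*_m M` is bijective for every `m`. If `ω(v, ·)` vanishes
on `T_m M`, maximal isotropy forces `v ∈ T_m M`. Since `τ v = v`, the vector `v` is then
`γ`-orthogonal to `T_m M`, hence zero. This gives injectivity, and the real dimensions agree: `dim
V^τ = dim_ℂ V = 2 dim_ℂ M = dim_ℝ T*_m M`.

Translations by `V^τ` are therefore transitive on each fibre of `N → M`, so the orbit of `σ` under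
`V^τ ⋊ A` is the full preimage of the `A`-orbit of its base point (`affineOrbit_eq_preimage`).

It remains to see that taking preimages in `T*M` preserves codimension
(`HasCodimension.preimage_proj`). If `f : P → M` is an injective immersion onto the orbit, `√-1 ψ`
trivializes the pull back of `T*M`, and `(x, v) ↦ (f x, √-1 ψ_{f x}(v))` is an injective immersion
of `P × V^τ` onto the preimage. Source and target both gain the dimension of a fibre. -/

noncomputable section

namespace FundamentalData

/-! ### Real structures and Lagrangean subspaces. -/

section Algebra

variable {V : Type*} [AddCommGroup V] [Module ℂ V] (D : FundamentalData V)

theorem form_swap (u v : V) : D.form u v = -D.form v u := by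
  have h := D.form_self (u + v)
  simp only [map_add, LinearMap.add_apply, D.form_self, zero_add, add_zero] at h
  exact eq_neg_of_add_eq_zero_right h

/-- Every vector decomposes into a real and an imaginary part. -/
theorem exists_add_I_smul (u : V) :
    ∃ a ∈ D.realPart, ∃ b ∈ D.realPart, u = a + Complex.I • b := by
  refine ⟨(1 / 2 : ℂ) • (u + D.conj u), ?_, (-(1 / 2 : ℂ) * Complex.I) • (u - D.conj u), ?_, ?_⟩
  · rw [D.mem_realPart, LinearMap.map_smulₛₗ, map_add, D.conj_conj]
    simp only [map_div₀, map_one, map_ofNat, add_comm]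
  · rw [D.mem_realPart, LinearMap.map_smulₛₗ, map_sub, D.conj_conj]
    simp only [map_mul, map_neg, Complex.conj_I, map_div₀, map_one, map_ofNat]
    module
  · have h : Complex.I * (-(1 / 2 : ℂ) * Complex.I) = 1 / 2 := by
      linear_combination (-(1 / 2 : ℂ)) * Complex.I_mul_I
    rw [smul_smul, h]
    module

theorem conj_add_I_smul {a b : V} (ha : a ∈ D.realPart) (hb : b ∈ D.realPart) :
    D.conj (a + Complex.I • b) = a - Complex.I • b := by
  rw [map_add, LinearMap.map_smulₛₗ, D.mem_realPart.1 ha, D.mem_realPart.1 hb, Complex.conj_I,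
    neg_smul, sub_eq_add_neg]

/-- `ω` is compatible with the real structure. -/
theorem form_conj_conj (u v : V) :
    D.form (D.conj u) (D.conj v) = starRingEnd ℂ (D.form u v) := by
  -- On real vectors the claim is the reality of `ω`; the general case follows by expanding both
  -- arguments into real and imaginary parts.
  have key : ∀ a ∈ D.realPart, ∀ b ∈ D.realPart,
      starRingEnd ℂ (D.form a b) = D.form a b := fun a ha b hb =>
    Complex.conj_eq_iff_im.2 (D.form_real a b ha hb)
  obtain ⟨a, ha, b, hb, rfl⟩ := D.exists_add_I_smul u
  obtain ⟨c, hc, d, hd, rfl⟩ := D.exists_add_I_smul v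
  rw [D.conj_add_I_smul ha hb, D.conj_add_I_smul hc hd]
  simp only [map_add, map_sub, map_smul, LinearMap.add_apply, LinearMap.sub_apply,
    LinearMap.smul_apply, smul_eq_mul, map_mul, Complex.conj_I, key a ha c hc, key a ha d hd,
    key b hb c hc, key b hb d hd]
  ring

theorem hermForm_conj_symm (u v : V) :
    starRingEnd ℂ (D.hermForm u v) = D.hermForm v u := by
  unfold hermForm
  rw [map_mul, ← D.form_conj_conj, D.conj_conj, D.form_swap, Complex.conj_I]
  ring

/-- A vector orthogonal to a Lagrangean subspace belongs to it. -/
theorem mem_of_isLagrangean {T : Submodule ℂ V}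
    (hT : IsLagrangean (fun u v => D.form u v) ⊤ T) {v : V} (hv : ∀ u ∈ T, D.form v u = 0) :
    v ∈ T := by
  -- Adjoining the line of `v` keeps the subspace isotropic, so maximality forbids any enlargement.
  have hle : T ⊔ Submodule.span ℂ {v} ≤ T := by
    refine hT.le_of_ge ⟨le_top, ?_⟩ le_sup_left
    intro x hx y hy
    obtain ⟨t, ht, p, hp, rfl⟩ := Submodule.mem_sup.1 hx
    obtain ⟨s, hs, q, hq, rfl⟩ := Submodule.mem_sup.1 hy
    obtain ⟨a, rfl⟩ := Submodule.mem_span_singleton.1 hp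
    obtain ⟨b, rfl⟩ := Submodule.mem_span_singleton.1 hq
    have h1 : D.form t s = 0 := hT.prop.2 t ht s hs
    have h2 : D.form t v = 0 := by rw [D.form_swap, hv t ht, neg_zero]
    simp [h1, h2, hv s hs, D.form_self]
  exact hle (Submodule.mem_sup_right (Submodule.mem_span_singleton_self v))

/-- Maximality makes `T` equal to its own `ω`-orthogonal, whose dimension is complementary because
`ω` is nondegenerate. -/
theorem finrank_of_isLagrangean [FiniteDimensional ℂ V] {T : Submodule ℂ V}
    (hT : IsLagrangean (fun u v => D.form u v) ⊤ T) :
    Module.finrank ℂ V = 2 * Module.finrank ℂ T := by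
  have hrefl : LinearMap.BilinForm.IsRefl D.form := fun u v h => by
    rw [D.form_swap, h, neg_zero]
  have hnd : LinearMap.BilinForm.Nondegenerate D.form :=
    (LinearMap.IsRefl.nondegenerate_iff_separatingLeft hrefl).2 D.form_nondegenerate
  have horth : LinearMap.BilinForm.orthogonal D.form T = T := by
    ext v
    refine ⟨fun hv => D.mem_of_isLagrangean hT fun u hu => ?_, fun hv u hu => hT.prop.2 u hu v hv⟩
    rw [D.form_swap, show D.form u v = 0 from hv u hu, neg_zero]
  have h := LinearMap.BilinForm.finrank_orthogonal hnd T
  rw [horth] at h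
  have := Submodule.finrank_le T
  omega

/-- `V` is the complexification of `V^τ`. -/
def realPartProdEquiv : (D.realPart × D.realPart) ≃ₗ[ℝ] V :=
  LinearEquiv.ofBijective
    { toFun := fun x => (x.1 : V) + Complex.I • (x.2 : V)
      map_add' := fun x y => by
        simp only [Prod.fst_add, Prod.snd_add, Submodule.coe_add]
        module
      map_smul' := fun c x => by
        simp only [Prod.smul_fst, Prod.smul_snd, Submodule.coe_smul, RingHom.id_apply, smul_add,
          ← Complex.coe_smul]
        module }
    ⟨(injective_iff_map_eq_zero _).2 fun x hx =>
        have h := LagrangeanSplitting.eq_zero_of_add_I_smul (D := D) x.1.2 x.2.2 hx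
        Prod.ext (Subtype.ext h.1) (Subtype.ext h.2),
      fun u => by
        obtain ⟨a, ha, b, hb, rfl⟩ := D.exists_add_I_smul u
        exact ⟨(⟨a, ha⟩, ⟨b, hb⟩), rfl⟩⟩

theorem finrank_realPart [FiniteDimensional ℂ V] :
    Module.finrank ℝ D.realPart = Module.finrank ℂ V := by
  have : FiniteDimensional ℝ V := FiniteDimensional.complexToReal V
  have h := D.realPartProdEquiv.finrank_eq
  rw [Module.finrank_prod, finrank_real_of_complex] at h
  omega

end Algebra

end FundamentalData

/-! ### The isomorphism between `V^τ` and the cotangent spaces of `M`. -/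

section Psi

variable {V : Type*} [NormedAddCommGroup V] [NormedSpace ℂ V] [FiniteDimensional ℂ V]
  {E : Type*} [NormedAddCommGroup E] [NormedSpace ℂ E]
  {M : Set V} [ChartedSpace E M] {D : FundamentalData V}

open LagrangeanSplitting

namespace IsLagrangeanPseudoKahler

/-- The point `m` is needed: for empty `M` nothing bounds the dimension of `E`. -/
theorem finiteDimensional (hM : IsLagrangeanPseudoKahler E M D) (m : M) :
    FiniteDimensional ℂ E :=
  FiniteDimensional.of_injective (V := E) (inclDeriv E M m).toLinearMap (hM.immersion m)

theorem finrank_eq (hM : IsLagrangeanPseudoKahler E M D) (m : M) :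
    Module.finrank ℂ V = 2 * Module.finrank ℂ E := by
  rw [D.finrank_of_isLagrangean (hM.lagrangean m)]
  exact congrArg (2 * ·) (LinearMap.finrank_range_of_inj (M := E) (hM.immersion m))

theorem finrank_covector (hM : IsLagrangeanPseudoKahler E M D) (m : M) :
    Module.finrank ℝ (E →L[ℂ] ℂ) = Module.finrank ℝ D.realPart := by
  have := hM.finiteDimensional m
  have h : Module.finrank ℂ (E →L[ℂ] ℂ) = Module.finrank ℂ E :=
    (LinearMap.toContinuousLinearMap (𝕜 := ℂ) (E := E) (F' := ℂ)).finrank_eq.symm.trans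
      Subspace.dual_finrank_eq
  rw [finrank_real_of_complex, h, D.finrank_realPart, hM.finrank_eq m]

/-- This is where the pseudo-Kähler condition enters. The Lagrangean condition puts `v` in `T_m M`,
and for real `v` orthogonality for `ω` and for `γ` coincide. Hermitian symmetry moves `v` to the
slot carrying `τ`. -/
theorem psi_eq_zero (hM : IsLagrangeanPseudoKahler E M D) (m : M) {v : D.realPart}
    (h : psi E D m v = 0) : v = 0 := by
  have h1 : ∀ u ∈ tangentSubspace E M m, D.form (v : V) u = 0 := by
    rintro _ ⟨X, rfl⟩
    exact DFunLike.congr_fun h X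
  have hv : (v : V) ∈ tangentSubspace E M m := D.mem_of_isLagrangean (hM.lagrangean m) h1
  refine Subtype.ext (hM.nondegenerate m v hv fun u hu => ?_)
  rw [← D.hermForm_conj_symm]
  unfold FundamentalData.hermForm
  rw [D.mem_realPart.1 v.2, D.form_swap, h1 u hu]
  simp

end IsLagrangeanPseudoKahler

variable (E D) in
/-- The map `√-1 ψ_m : V^τ → T*_m M` as a real linear map. -/
def psiLinear (m : M) : D.realPart →ₗ[ℝ] (E →L[ℂ] ℂ) where
  toFun v := Complex.I • psi E D m v
  map_add' v w := by
    rw [psi_add]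
    exact smul_add (A := E →L[ℂ] ℂ) _ _ _
  map_smul' c v := by
    ext X
    change Complex.I * D.form (c • (v : V)) (inclDeriv E M m X)
      = c • (Complex.I * D.form (v : V) (inclDeriv E M m X))
    rw [← Complex.coe_smul c (v : V), map_smul, LinearMap.smul_apply, smul_eq_mul,
      Complex.real_smul]
    ring

theorem psiLinear_bijective (hM : IsLagrangeanPseudoKahler E M D) (m : M) :
    Function.Bijective (psiLinear E D m) := by
  have := hM.finiteDimensional m
  have hinj : Function.Injective (psiLinear E D m) :=
    (injective_iff_map_eq_zero _).2 fun v hv => hM.psi_eq_zero m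
      ((smul_eq_zero (M := E →L[ℂ] ℂ)).1 hv |>.resolve_left Complex.I_ne_zero)
  have : FiniteDimensional ℝ V := FiniteDimensional.complexToReal V
  have : FiniteDimensional ℝ (E →L[ℂ] ℂ) := FiniteDimensional.complexToReal _
  exact ⟨hinj, (LinearMap.injective_iff_surjective_of_finrank_eq_finrank
    (hM.finrank_covector m).symm).1 hinj⟩

end Psi

/-- A holomorphic map from a complex manifold to a vector space is real differentiable. -/
theorem ContMDiffAt.complexToReal {E W X : Type*} [NormedAddCommGroup E] [NormedSpace ℂ E]
    [NormedAddCommGroup W] [NormedSpace ℂ W] [TopologicalSpace X] [ChartedSpace E X]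
    {n : ℕ∞ω} {f : X → W} {x : X} (h : ContMDiffAt 𝓘(ℂ, E) 𝓘(ℂ, W) n f x) :
    ContMDiffAt 𝓘(ℝ, E) 𝓘(ℝ, W) n f x := by
  rw [contMDiffAt_iff] at h ⊢
  exact ⟨h.1, h.2.restrict_scalars ℝ⟩

/-! ### The pull back of `T*M` along an immersion, trivialized by `√-1 ψ`. -/

section Fibre

open LagrangeanSplitting

variable {V : Type*} [NormedAddCommGroup V] [NormedSpace ℂ V] [FiniteDimensional ℂ V]
  {E : Type*} [NormedAddCommGroup E] [NormedSpace ℂ E]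
  {M : Set V} [ChartedSpace E M] [IsManifold 𝓘(ℂ, E) ω M] {D : FundamentalData V}

variable (E) in
/-- The differential of `M ⊂ V` at `m` in the trivialization of the tangent bundle at `m₀`. -/
def frame (m₀ m : M) : E →L[ℂ] V :=
  inclDeriv E M m ∘L (trivializationAt E (TangentSpace 𝓘(ℂ, E) : M → Type _) m₀).symmL ℂ m

/-- The frame is the differential of the holomorphic inclusion in tangent coordinates, hence
holomorphic near `m₀` and a fortiori smooth over `ℝ`. -/
theorem contMDiffAt_frame (hM : IsLagrangeanPseudoKahler E M D) (m₀ : M) :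
    ContMDiffAt 𝓘(ℝ, E) 𝓘(ℝ, E →L[ℂ] V) ∞ (frame E m₀) m₀ := by
  have h := ContMDiffAt.mfderiv_const (m := ∞) (hM.contMDiff_val m₀) (by simp)
  have h1 : frame E m₀ = inTangentCoordinates 𝓘(ℂ, E) 𝓘(ℂ, V) id (Subtype.val : M → V)
      (mfderiv 𝓘(ℂ, E) 𝓘(ℂ, V) (Subtype.val : M → V)) m₀ := by
    funext m
    unfold frame inTangentCoordinates ContinuousLinearMap.inCoordinates
    rw [TangentBundle.continuousLinearMapAt_model_space]
    rfl
  rw [h1]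
  exact ContMDiffAt.complexToReal h

variable (D) in
/-- The form `√-1 ω` as a continuous bilinear map. -/
def formI : V →L[ℂ] V →L[ℂ] ℂ :=
  LinearMap.toContinuousLinearMap
    ((LinearMap.toContinuousLinearMap (𝕜 := ℂ) (E := V) (F' := ℂ)).toLinearMap ∘ₗ
      (Complex.I • D.form))

/-- In bundle coordinates `√-1 ψ` becomes a fixed bilinear expression in `v` and the frame, so its
smoothness and its fibre derivative can be read off in vector spaces. -/
theorem trivializationAt_psiLinear (m₀ m : M) (v : D.realPart) :
    (trivializationAt (E →L[ℂ] ℂ) (Covector E M) m₀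
      (⟨m, psiLinear E D m v⟩ : Cotangent E M)).2 = formI D (v : V) ∘L frame E m₀ m := by
  rw [hom_trivializationAt_apply]
  ext X
  exact DFunLike.congr_fun (Trivial.continuousLinearMapAt_trivialization ℂ M ℂ m) _

theorem contDiff_formI_comp :
    ContDiff ℝ ∞ (fun p : V × (E →L[ℂ] V) => formI D p.1 ∘L p.2) := by
  have h : ContDiff ℂ ∞ (fun p : V × (E →L[ℂ] V) => formI D p.1 ∘L p.2) :=
    ((formI D).contDiff.comp contDiff_fst).clm_comp contDiff_snd
  exact h.restrict_scalars ℝ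

variable {F P W : Type*} [NormedAddCommGroup F] [NormedSpace ℝ F] [TopologicalSpace P]
  [ChartedSpace F P] [NormedAddCommGroup W] [NormedSpace ℝ W] [FiniteDimensional ℝ W]

/-- The pull back of `T*M` along `f : P → M`, trivialized by `√-1 ψ`. -/
def pullbackMap (f : P → M) (e : W ≃ₗ[ℝ] D.realPart) (x : P × W) : Cotangent E M :=
  ⟨f x.1, psiLinear E D (f x.1) (e x.2)⟩

theorem contMDiff_pullbackMap (hM : IsLagrangeanPseudoKahler E M D) {f : P → M}
    (hf : ContMDiff 𝓘(ℝ, F) 𝓘(ℝ, E) ∞ f) (e : W ≃ₗ[ℝ] D.realPart) :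
    ContMDiff (𝓘(ℝ, F).prod 𝓘(ℝ, W)) (𝓘(ℝ, E).prod 𝓘(ℝ, E →L[ℂ] ℂ)) ∞
      (pullbackMap (E := E) f e) := by
  intro x
  rw [contMDiffAt_totalSpace]
  refine ⟨(hf x.1).comp x contMDiffAt_fst, ?_⟩
  let e' : W →L[ℝ] V := (D.realPart.subtype ∘ₗ e.toLinearMap).toContinuousLinearMap
  have h1 : ContMDiffAt (𝓘(ℝ, F).prod 𝓘(ℝ, W)) 𝓘(ℝ, V) ∞ (fun y : P × W => e' y.2) x :=
    e'.contMDiff.contMDiffAt.comp x contMDiffAt_snd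
  have h2 : ContMDiffAt (𝓘(ℝ, F).prod 𝓘(ℝ, W)) 𝓘(ℝ, E →L[ℂ] V) ∞
      (fun y : P × W => frame E (f x.1) (f y.1)) x :=
    (contMDiffAt_frame hM (f x.1)).comp x ((hf x.1).comp x contMDiffAt_fst)
  have h3 := (contDiff_formI_comp (D := D) (E := E)).contMDiff.contMDiffAt.comp x
    (h1.prodMk_space h2)
  refine h3.congr_of_eventuallyEq (Filter.Eventually.of_forall fun y => ?_)
  exact trivializationAt_psiLinear _ _ _

theorem pullbackMap_injective (hM : IsLagrangeanPseudoKahler E M D) {f : P → M}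
    (hf : Function.Injective f) (e : W ≃ₗ[ℝ] D.realPart) :
    Function.Injective (pullbackMap (E := E) f e) := by
  rintro ⟨x, b⟩ ⟨y, c⟩ h
  obtain rfl : x = y := hf (congrArg TotalSpace.proj h)
  have h2 : psiLinear E D (f x) (e b) = psiLinear E D (f x) (e c) :=
    eq_of_heq (TotalSpace.mk.inj h).2
  rw [e.injective ((psiLinear_bijective hM (f x)).1 h2)]

theorem range_pullbackMap (hM : IsLagrangeanPseudoKahler E M D) (f : P → M)
    (e : W ≃ₗ[ℝ] D.realPart) :
    Set.range (pullbackMap (E := E) f e) = TotalSpace.proj ⁻¹' Set.range f := by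
  ext σ
  constructor
  · rintro ⟨x, rfl⟩
    exact ⟨x.1, rfl⟩
  · obtain ⟨m, s⟩ := σ
    rintro ⟨x, rfl : f x = m⟩
    -- Surjectivity of `√-1 ψ` makes the image contain whole fibres.
    obtain ⟨v, hv⟩ := (psiLinear_bijective hM (f x)).2 s
    refine ⟨(x, e.symm v), ?_⟩
    unfold pullbackMap
    rw [e.apply_symm_apply, hv]

/-- The map `√-1 ψ_m` in the trivialization of `T*M` at `m`. -/
def psiCoord (e : W ≃ₗ[ℝ] D.realPart) (m : M) : W →L[ℝ] (E →L[ℂ] ℂ) :=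
  LinearMap.toContinuousLinearMap
    { toFun := fun c => formI D (e c : V) ∘L frame E m m
      map_add' := fun b c => by
        rw [map_add, Submodule.coe_add, map_add, ContinuousLinearMap.add_comp]
      map_smul' := fun a c => by
        rw [map_smul, Submodule.coe_smul, ← Complex.coe_smul a (e c : V), map_smul,
          ContinuousLinearMap.smul_comp]
        exact Complex.coe_smul a (formI D (e c : V) ∘L frame E m m) }

theorem psiCoord_injective (hM : IsLagrangeanPseudoKahler E M D) (e : W ≃ₗ[ℝ] D.realPart)
    (m : M) : Function.Injective (psiCoord (E := E) e m) := by
  intro b c h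
  have h1 : formI D (e b : V) ∘L frame E m m = formI D (e c : V) ∘L frame E m m := h
  rw [← trivializationAt_psiLinear, ← trivializationAt_psiLinear] at h1
  have hs : ∀ s : Covector E M m, (⟨m, s⟩ : Cotangent E M) ∈
      (trivializationAt (E →L[ℂ] ℂ) (Covector E M) m).source := fun s =>
    (trivializationAt (E →L[ℂ] ℂ) (Covector E M) m).mem_source.2
      (mem_baseSet_trivializationAt (E →L[ℂ] ℂ) (Covector E M) m)
  have h2 := (trivializationAt (E →L[ℂ] ℂ) (Covector E M) m).injOn
    (hs (psiLinear E D m (e b))) (hs (psiLinear E D m (e c))) (Prod.ext rfl h1)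
  exact e.injective ((psiLinear_bijective hM m).1 (eq_of_heq (TotalSpace.mk.inj h2).2))

/-- The differential is block triangular: its base component is `df`, and on vertical vectors it is
`√-1 ψ` in coordinates. Both diagonal blocks are injective. -/
theorem mfderiv_pullbackMap_injective (hM : IsLagrangeanPseudoKahler E M D) {f : P → M}
    (hf : ContMDiff 𝓘(ℝ, F) 𝓘(ℝ, E) ∞ f)
    (hf' : ∀ x, Function.Injective (mfderiv 𝓘(ℝ, F) 𝓘(ℝ, E) f x))
    (e : W ≃ₗ[ℝ] D.realPart) (x : P × W) :
    Function.Injective (mfderiv (𝓘(ℝ, F).prod 𝓘(ℝ, W)) (𝓘(ℝ, E).prod 𝓘(ℝ, E →L[ℂ] ℂ))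
      (pullbackMap (E := E) f e) x) := by
  have hg : MDifferentiableAt (𝓘(ℝ, F).prod 𝓘(ℝ, W)) (𝓘(ℝ, E).prod 𝓘(ℝ, E →L[ℂ] ℂ))
      (pullbackMap (E := E) f e) x := (contMDiff_pullbackMap hM hf e).mdifferentiable (by simp) x
  refine (injective_iff_map_eq_zero (G := F × W) (H := E × (E →L[ℂ] ℂ))
    (F := F × W →L[ℝ] E × (E →L[ℂ] ℂ)) _).2 ?_
  rintro ⟨a, b⟩ hab
  -- Composing with the bundle projection leaves `f ∘ Prod.fst`, whose differential sends `(a, b)`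
  -- to `df a`.
  have ha : a = 0 := by
    have hπ : MDifferentiableAt (𝓘(ℝ, E).prod 𝓘(ℝ, E →L[ℂ] ℂ)) 𝓘(ℝ, E)
        (TotalSpace.proj : Cotangent E M → M) (pullbackMap (E := E) f e x) :=
      (contMDiffAt_proj (n := 1) (Covector E M)).mdifferentiableAt (by simp)
    have h1 := mfderiv_comp x hπ hg
    have h2 : (TotalSpace.proj : Cotangent E M → M) ∘ pullbackMap (E := E) f e
        = f ∘ Prod.fst := rfl
    rw [h2, mfderiv_comp x (hf.mdifferentiable (by simp) x.1) mdifferentiableAt_fst,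
      mfderiv_fst] at h1
    have h3 := DFunLike.congr_fun h1 (a, b)
    refine (injective_iff_map_eq_zero (G := F) (H := E) (F := F →L[ℝ] E) _).1 (hf' x.1) a (h3.trans ?_)
    exact (congrArg (fun ξ => (mfderiv (𝓘(ℝ, E).prod 𝓘(ℝ, E →L[ℂ] ℂ)) 𝓘(ℝ, E)
      (TotalSpace.proj : Cotangent E M → M) (pullbackMap (E := E) f e x)) ξ) hab).trans
        (ContinuousLinearMap.map_zero _)
  subst ha
  have hτ : MDifferentiableAt (𝓘(ℝ, E).prod 𝓘(ℝ, E →L[ℂ] ℂ)) 𝓘(ℝ, E →L[ℂ] ℂ)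
      (fun σ : Cotangent E M => (trivializationAt (E →L[ℂ] ℂ) (Covector E M) (f x.1) σ).2)
      (pullbackMap (E := E) f e x) :=
    ((contMDiffAt_totalSpace (n := 1)).1
      (contMDiffAt_id (x := pullbackMap (E := E) f e x))).2.mdifferentiableAt (by simp)
  -- Restricted to the slice over `x.1` and read in the trivialization, the map is the continuous
  -- linear map `psiCoord`, which is its own derivative.
  have hι : MDifferentiableAt 𝓘(ℝ, W) (𝓘(ℝ, F).prod 𝓘(ℝ, W)) (fun c : W => (x.1, c)) x.2 :=
    mdifferentiableAt_const.prodMk mdifferentiableAt_id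
  have h1 := mfderiv_comp x.2 (hτ.comp x hg) hι
  have h2 : ((fun σ : Cotangent E M =>
      (trivializationAt (E →L[ℂ] ℂ) (Covector E M) (f x.1) σ).2) ∘ pullbackMap (E := E) f e) ∘
        (fun c : W => (x.1, c)) = psiCoord (E := E) e (f x.1) :=
    funext fun c => trivializationAt_psiLinear _ _ _
  rw [h2, mfderiv_comp x hτ hg, mfderiv_prod_right, ContinuousLinearMap.mfderiv_eq] at h1
  have hb : b = 0 := by
    refine (injective_iff_map_eq_zero _).1 (psiCoord_injective hM e (f x.1)) b ?_
    refine (DFunLike.congr_fun h1 b).trans ?_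
    exact (congrArg (fun ξ => (mfderiv (𝓘(ℝ, E).prod 𝓘(ℝ, E →L[ℂ] ℂ)) 𝓘(ℝ, E →L[ℂ] ℂ)
      (fun σ : Cotangent E M => (trivializationAt (E →L[ℂ] ℂ) (Covector E M) (f x.1) σ).2)
        (pullbackMap (E := E) f e x)) ξ) hab).trans (ContinuousLinearMap.map_zero _)
  rw [hb]
  rfl

end Fibre

/-! ### Orbits on `T*M` as preimages of orbits on `M`, and their codimension. -/

section Orbit

open LagrangeanSplitting

variable {V : Type*} [NormedAddCommGroup V] [NormedSpace ℂ V] [FiniteDimensional ℂ V]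
  {E : Type*} [NormedAddCommGroup E] [NormedSpace ℂ E]
  {M : Set V} [ChartedSpace E M] {D : FundamentalData V} {S : LagrangeanSplitting D}

/-- The orbits of `V^τ ⋊ A` on `T*M` are the preimages of the orbits of `A` on `M`. -/
theorem affineOrbit_eq_preimage (hM : IsLagrangeanPseudoKahler E M D)
    (hp : InGeneralPosition E M S) (A : Subgroup (S.autSD M)) (σ : Cotangent E M) :
    S.affineOrbit hM hp A σ = TotalSpace.proj ⁻¹' MulAction.orbit A σ.proj := by
  ext ρ
  constructor
  · rintro ⟨g, rfl⟩
    exact ⟨⟨g.1.right, g.2⟩, rfl⟩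
  · obtain ⟨m, s⟩ := ρ
    rintro ⟨φ, rfl⟩
    -- After `φ` has moved the base point, `v` is chosen so that its translation makes up the
    -- difference between the transported covector and the target `s`.
    obtain ⟨v, hv⟩ := (psiLinear_bijective hM ((φ : S.autSD M) • σ.proj)).2
      (s - pushCovector (φ : S.autSD M) σ.proj σ.snd)
    refine ⟨⟨⟨Multiplicative.ofAdd v, φ⟩, φ.2⟩, ?_⟩
    refine congrArg (TotalSpace.mk (F := E →L[ℂ] ℂ) ((φ : S.autSD M) • σ.proj)) ?_
    exact (congrArg (pushCovector (φ : S.autSD M) σ.proj σ.snd + ·) hv).trans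
      (add_sub_cancel (G := E →L[ℂ] ℂ) _ _)

theorem HasCodimension.preimage_proj [IsManifold 𝓘(ℂ, E) ω M]
    (hM : IsLagrangeanPseudoKahler E M D) (m : M) {O : Set M} {r : ℕ}
    (hO : HasCodimension 𝓘(ℝ, E) O r) :
    HasCodimension (𝓘(ℝ, E).prod 𝓘(ℝ, E →L[ℂ] ℂ))
      ((TotalSpace.proj : Cotangent E M → M) ⁻¹' O) r := by
  obtain ⟨F, _, _, _, P, _, _, _, _, _, f, hf, hinj, hf', hrange, hdim⟩ := hO
  have := hM.finiteDimensional m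
  have : FiniteDimensional ℝ V := FiniteDimensional.complexToReal V
  have : FiniteDimensional ℝ E := FiniteDimensional.complexToReal E
  have : FiniteDimensional ℝ (E →L[ℂ] ℂ) := FiniteDimensional.complexToReal _
  -- A Euclidean copy of `V^τ` is used because `HasCodimension` asks for a manifold and model space
  -- in the lowest universe.
  let W := EuclideanSpace ℝ (Fin (Module.finrank ℝ D.realPart))
  let e : W ≃ₗ[ℝ] D.realPart := LinearEquiv.ofFinrankEq _ _ (by simp [W])
  have hmodel : 𝓘(ℝ, F × W) = 𝓘(ℝ, F).prod 𝓘(ℝ, W) := modelWithCornersSelf_prod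
  refine ⟨F × W, inferInstance, inferInstance, inferInstance, P × W, inferInstance,
    inferInstance, inferInstance, inferInstanceAs (ChartedSpace (ModelProd F W) (P × W)), ?_,
    pullbackMap (E := E) f e, ?_, pullbackMap_injective hM hinj e, ?_, ?_, ?_⟩
  · rw [hmodel]
    exact inferInstanceAs (IsManifold (𝓘(ℝ, F).prod 𝓘(ℝ, W)) ∞ (P × W))
  · rw [hmodel]
    exact contMDiff_pullbackMap hM hf e
  · rw [hmodel]
    exact mfderiv_pullbackMap_injective hM hf hf' e
  · rw [range_pullbackMap hM, hrange]
  · have h := hM.finrank_covector m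
    rw [Module.finrank_prod, Module.finrank_prod, h, ← hdim, e.finrank_eq]
    ring

end Orbit

end

theorem mainTheorem8
    {V : Type*} [NormedAddCommGroup V] [NormedSpace ℂ V] [FiniteDimensional ℂ V]
    {E : Type*} [NormedAddCommGroup E] [NormedSpace ℂ E]
    (D : FundamentalData V) (S : LagrangeanSplitting D)
    (M : Set V) [ChartedSpace E M] [IsManifold 𝓘(ℂ, E) ω M]
    (hM : IsLagrangeanPseudoKahler E M D) (hp : InGeneralPosition E M S)
    (A : Subgroup (S.autSD M)) (r : ℕ)
    (hA : ∃ m : M, HasCodimension 𝓘(ℝ, E) (MulAction.orbit A m) r) :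
    ∃ σ : Cotangent E M,
      HasCodimension (𝓘(ℝ, E).prod 𝓘(ℝ, E →L[ℂ] ℂ)) (S.affineOrbit hM hp A σ) r := by
  obtain ⟨m, hm⟩ := hA
  -- Any covector over `m` would do, since the orbit depends only on the base point.
  refine ⟨⟨m, 0⟩, ?_⟩
  rw [affineOrbit_eq_preimage]
  exact hm.preimage_proj hM m
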